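/- Let $d$ be a prime and $\omega=e^{2\pi i/d}$; indices are taken in $\mathbb Z/d\mathbb Z$. On $\mathbb C^d$ with orthonormal basis $|k\rangle$ put $$Z=\sum_k\omega^k|k\rangle\langle k|,\quad X=\sum_k|k-1\rangle\langle k|,\quad |+_j\rangle=\tfrac1{\sqrt d}\sum_k\omega^{jk}|k\rangle,\quad F=\sum_k|+_k\rangle\langle k|,\quad S_c=\sum_k|ck\rangle\langle k|$$ ($c$ a unit of $\mathbb Z/d\mathbb Z$). For an operator $U$ with an orthonormal basis of eigenvectors $v_j$ ($j\in\mathbb Z/d\mathbb Z$) and $\mathbf a\in\mathbb R^d$ let $U(\mathbf a)=\sum_j e^{ia_j}|v_j\rangle\langle v_j|$; in particular $Z(\mathbf a)=\sum_k e^{ia_k}|k\rangle\langle k|$. *Implementation on a linear cluster.* The linear cluster of $n+1$ qudits with input $\psi$ is obtained by preparing qudit $0$ in the state $\psi$ and qudits $1,\dots,n$ in $|+_0\rangle$, and applying the controlled-$Z$ gate $|k\rangle|l\rangle\mapsto\omega^{kl}|k\rangle|l\rangle$ to all pairs of neighbours. A gate $G$ is *implemented by $n$ adaptive one-dit teleportations*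 if for every known error $E=X^xZ^zS_c$ there is an adaptive choice of measurements of qudits $0,\dots,n-1$ in bases $\{(FZ(\mathbf a_i))^\dagger|m\rangle\}_m$, where $\mathbf a_i$ may depend on the outcomes at qudits $0,\dots,i-1$, and for every string of outcomes $m=(m_0,\dots,m_{n-1})$ an error $E'_m=X^{x'}Z^{z'}S_{c'}$ depending only on $E$ and $m$, such that for every input $E\psi$ and every $m$ the (unnormalised) state of the last qudit after outcomes $m$ is $d^{-n/2}\,\theta_m\,E'_m\,G\,\psi$ with $|\theta_m|=1$ independent of $\psi$. In particular, when $G$ is unitary, all outcome strings have probability $d^{-n}$. Then: 1. $\{|k\rangle\}$ and $\{|+_j\rangle\}$ are orthonormal eigenbases of $Z$ and $X$, and each of the $d+1$ operators $Z,X,ZX,ZX^2,\dots,ZX^{d-1}$ has an orthonormal basis of eigenvectors. 2. For every choice of orthonormal eigenbases of these $d+1$ operators: (a) the $d+1$ bases are pairwise mutually unbiased, i.e. $|\langle v|w\rangle|=1/\sqrt d$ for $v$, $w$ in different bases; (b) the real linear span of the projectors $|v\rangle\langle v|$ onto the basis vectors is exactly the space of Hermitian $d\times d$ matrices; (c) for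 every $\mathbf a\in\mathbb R^d$, the gates $Z(\mathbf a)$ and $X(\mathbf a)$ are implemented by two, and $ZX^k(\mathbf a)$, $1\le k\le d-1$, by four adaptive one-dit teleportations; (d) the finite products of the gates $Z(\mathbf a)$, $X(\mathbf a)$, $ZX^k(\mathbf a)$ with $1\le k\le d-1$ and $\mathbf a\in[0,2\pi]^d$ are exactly the elements of $U(d)$. 3. Consequently every $U\in U(d)$ is implemented by some finite number of adaptive one-dit teleportations on a linear cluster. -/

import Mathlib

open scoped Matrix

noncomputable section

namespace QuditCluster

variable (d : ℕ) [NeZero d]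

/-- The space `ℂ^d` of one qudit, with computational basis indexed by `ℤ/dℤ`. -/
abbrev Ket : Type := EuclideanSpace ℂ (ZMod d)

/-- Matrices in the computational basis. -/
abbrev Op : Type := Matrix (ZMod d) (ZMod d) ℂ

/-- The phase `ω ^ k`, where `ω = exp (2 π i / d)` and `k` is a residue modulo `d`
(the standard additive character of `ℤ/dℤ`). -/
def om (k : ZMod d) : ℂ := ZMod.stdAddChar k

/-- `Z = ∑ₖ ω ^ k |k⟩⟨k|`. -/
def opZ : Op d := Matrix.diagonal (om d)

/-- `X = ∑ₖ |k - 1⟩⟨k|`. -/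
def opX : Op d := Matrix.of fun i k => if i = k - 1 then 1 else 0

/-- The Fourier gate `F = d^(-1/2) ∑_{j,k} ω ^ (j k) |j⟩⟨k|`. -/
def opF : Op d := Matrix.of fun j k => ((Real.sqrt d : ℝ) : ℂ)⁻¹ * om d (j * k)

/-- For a unit `c` of `ℤ/dℤ`, the permutation operator `S_c = ∑ₖ |c k⟩⟨k|`. -/
def opS (c : (ZMod d)ˣ) : Op d := Matrix.of fun i k => if i = (c : ZMod d) * k then 1 else 0

/-- The phase transformation `∑ₖ exp (i aₖ) |k⟩⟨k|`. -/
def phase (a : ZMod d → ℝ) : Op d :=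
  Matrix.diagonal fun k => Complex.exp (Complex.I * (a k : ℂ))

/-- The computational basis vector `|k⟩`. -/
def ket (k : ZMod d) : Ket d := EuclideanSpace.single k 1

/-- The Fourier basis vector `|+_j⟩ = d^(-1/2) ∑ₖ ω ^ (j k) |k⟩`. -/
def ketPlus (j : ZMod d) : Ket d :=
  WithLp.toLp 2 fun k => ((Real.sqrt d : ℝ) : ℂ)⁻¹ * om d (j * k)

variable {d}

/-! ### Eigenbases and the gates attached to them -/

/-- The operator `|v⟩⟨v|`. For a unit vector it is the projector onto the line of `v`. -/
def proj (v : Ket d) : Op d := Matrix.of fun x y => v x * star (v y)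

/-- The gate `U(a) = ∑ⱼ exp (i aⱼ) |vⱼ⟩⟨vⱼ|`, where `v` is an orthonormal basis of
eigenvectors of `U`. -/
def gate (v : ZMod d → Ket d) (a : ZMod d → ℝ) : Op d :=
  ∑ j, Complex.exp (Complex.I * (a j : ℂ)) • proj (v j)

/-- `v` is an orthonormal basis of `ℂ^d` consisting of eigenvectors of `U`
(an orthonormal family of `d` vectors is a basis). -/
def IsEigenbasis (U : Op d) (v : ZMod d → Ket d) : Prop :=
  Orthonormal ℂ v ∧ ∀ j, ∃ μ : ℂ, Module.End.HasEigenvector (Matrix.toEuclideanLin U) μ (v j)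

/-- Two families of vectors (in practice two orthonormal bases) are mutually unbiased. -/
def MutuallyUnbiased (v w : ZMod d → Ket d) : Prop :=
  ∀ i j, ‖inner ℂ (v i) (w j)‖ = 1 / Real.sqrt d

variable (d) in
/-- The `d + 1` operators `X` (index `none`) and `Z X ^ k`, `k = 0, …, d - 1` (index `some k`);
`Z` itself has the index `some 0`. -/
def mubOp : Option (ZMod d) → Op d
  | none => opX d
  | some k => opZ d * opX d ^ k.val

/-- Given eigenbases of the operators above, the set of all gates `U(a)` with
`a ∈ [0, 2π]^d` and `U` one of these operators. -/
def gateSet (v : Option (ZMod d) → ZMod d → Ket d) : Set (Op d) :=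
  {G | ∃ i, ∃ a : ZMod d → ℝ, (∀ j, a j ∈ Set.Icc 0 (2 * Real.pi)) ∧ G = gate (v i) a}

/-! ### Computation on a linear cluster

Qudits `0, …, n` stand in a row. Vectors of one qudit are given here by their amplitudes in the
computational basis, vectors of `n + 1` qudits by amplitudes indexed by `Fin (n + 1) → ZMod d`. -/

/-- The linear cluster on `n + 1` qudits with input `ψ`: qudit `0` is prepared in `ψ`, the others
in `|+_0⟩`, and a controlled-`Z` gate, which multiplies the amplitude of `|k⟩|l⟩` by `ω ^ (k l)`,
is applied to each pair of neighbours. -/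
def clusterState (n : ℕ) (ψ : ZMod d → ℂ) (x : Fin (n + 1) → ZMod d) : ℂ :=
  (∏ i : Fin n, om d (x i.castSucc * x i.succ)) *
    (ψ (x 0) * ∏ i : Fin n, ketPlus d 0 (x i.succ))

/-- The orthonormal basis in which a qudit is measured in a one-dit teleportation with phases `a`:
the `m`-th vector is `(F Z(a))† |m⟩`, the `m`-th column of `(F Z(a))†`. -/
def measVec (a : ZMod d → ℝ) (m : ZMod d) : ZMod d → ℂ := fun x => (opF d * phase d a)ᴴ x m

/-- An adaptive choice of measurements of the qudits `0, …, n - 1`: the phases used at qudit `i`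
may depend on the outcomes obtained at the qudits before it. -/
abbrev Pattern (d n : ℕ) : Type := (i : Fin n) → (Fin i → ZMod d) → ZMod d → ℝ

/-- The unnormalised state of the last qudit after the qudits `0, …, n - 1` of the linear cluster
with input `ψ` have been measured according to `A` with outcomes `m`, that is, the partial inner
product of the cluster state with the basis vectors belonging to the outcomes. Its squared norm is
the probability of the outcomes `m` when `ψ` is a unit vector. -/
def residual (n : ℕ) (A : Pattern d n) (m : Fin n → ZMod d) (ψ : ZMod d → ℂ) : ZMod d → ℂ :=
  fun y => ∑ x : Fin n → ZMod d,
    (∏ i : Fin n, star (measVec (A i fun j => m (j.castLE i.isLt.le)) (m i) (x i))) *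
      clusterState n ψ (Fin.snoc (α := fun _ => ZMod d) x y)

/-- The classically correctable error operators are `X ^ x Z ^ z S_c`; they are recorded by the
data `(x, z, c)`. -/
abbrev Err (d : ℕ) : Type := ZMod d × ZMod d × (ZMod d)ˣ

/-- The operator `X ^ x Z ^ z S_c`. -/
def errOp (e : Err d) : Op d := opX d ^ e.1.val * opZ d ^ e.2.1.val * opS d e.2.2

/-- `G` is implemented by `n` adaptive one-dit teleportations along a linear cluster of `n + 1`
qudits. For every known error `e` on the input there are an adaptive pattern of measurements and a
classical computation `f` of the new error from the outcomes, such that for each string of outcomes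
`m` (all strings having the same probability `d ^ (-n)`) the input `e ψ` is taken to `f(m) G ψ`, up
to a global phase that does not depend on `ψ`. -/
def Implements (n : ℕ) (G : Op d) : Prop :=
  ∀ e : Err d, ∃ (A : Pattern d n) (f : (Fin n → ZMod d) → Err d),
    ∀ m : Fin n → ZMod d, ∃ θ : ℂ, ‖θ‖ = 1 ∧ ∀ ψ : ZMod d → ℂ,
      residual n A m (errOp e *ᵥ ψ) =
        (((Real.sqrt d : ℝ) : ℂ)⁻¹ ^ n * θ) • (errOp (f m) *ᵥ (G *ᵥ ψ))

end QuditCluster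

end

open QuditCluster

noncomputable section

set_option linter.unusedSectionVars false

namespace QuditCluster

variable {d : ℕ} [NeZero d]

/-! ### Basic facts about the operators -/

/-! Measuring the first qudit of a cluster with outcome `m` leaves a shorter cluster whose input is
`d^(-1/2) X^m F Z(a) ψ` (`residual_succ`). Implementability thus becomes the algebraic recursion
`Tel`. An error passes through a diagonal gate if its phases are permuted accordingly, and through
`F` by exchanging shifts and clocks, so the outcomes only change the error. As `F = S_{-1} F†`, two
steps yield `F† Z(b) F Z(a)`; this gives `Z(a)` and `X(b)`. An eigenbasis of `Z X^k`, `k ≠ 0`,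
consists up to phases and order of the columns of some `Z(c) F†`, whence four steps.

The `d + 1` operators commute pairwise up to a nontrivial power of `ω`. Hence each moves the
eigenvectors of another through `d` distinct eigenvalues, which gives eigenbases
(`orthonormal_orbit`) and unbiasedness (`norm_inner_eigenvectors`). Up to scalars every `Z^a X^b` is
a power of one of them, and these products span all matrices, so the projectors do too
(`span_proj_eq_top`).

For universality, a complex parameter for each projector supplies a gate phase (imaginary part) and
a coefficient of a Hermitian `H` (real part). The map to (product of gates)`(1 + H)` has surjective
derivative at `0`, so it covers a neighbourhood of `1`; at unitary values `H` must vanish. So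
products of gates contain all unitaries near `1`, and every unitary is a scalar times a power of one
of those. -/

lemma om_zero : om d 0 = 1 := by simp [om]

lemma om_add (a b : ZMod d) : om d (a + b) = om d a * om d b := by
  simp [om, AddChar.map_add_eq_mul]

lemma om_neg (a : ZMod d) : om d (-a) = star (om d a) := by
  simp only [om]
  rw [AddChar.map_neg_eq_conj]
  rfl

lemma om_nsmul (n : ℕ) (a : ZMod d) : om d (n * a) = om d a ^ n := by
  rw [← nsmul_eq_mul, om, om, AddChar.map_nsmul_eq_pow]

lemma norm_om (a : ZMod d) : ‖om d a‖ = 1 := by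
  simp only [om, ZMod.stdAddChar_apply, Circle.norm_coe]

lemma star_mul_om (a : ZMod d) : star (om d a) * om d a = 1 := by
  rw [← om_neg, ← om_add]; simp [om_zero]

lemma om_injective : Function.Injective (om d) := ZMod.injective_stdAddChar

lemma sum_om_mul (a : ZMod d) : ∑ k, om d (k * a) = if a = 0 then (d : ℂ) else 0 := by
  have := AddChar.sum_mulShift a (ZMod.isPrimitive_stdAddChar d)
  simpa [om, ZMod.card] using this

lemma sqrt_sq : ((Real.sqrt d : ℝ) : ℂ) * ((Real.sqrt d : ℝ) : ℂ) = d := by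
  rw [← Complex.ofReal_mul, Real.mul_self_sqrt (by positivity)]; simp

lemma sqrt_inv_sq : ((Real.sqrt d : ℝ) : ℂ)⁻¹ * ((Real.sqrt d : ℝ) : ℂ)⁻¹ = (d : ℂ)⁻¹ := by
  rw [← mul_inv, sqrt_sq]

lemma star_sqrt_inv : star (((Real.sqrt d : ℝ) : ℂ)⁻¹) = ((Real.sqrt d : ℝ) : ℂ)⁻¹ := by
  simp

lemma opF_apply (j k : ZMod d) : opF d j k = ((Real.sqrt d : ℝ) : ℂ)⁻¹ * om d (j * k) := rfl

lemma opX_pow_apply (n : ℕ) (i k : ZMod d) :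
    (opX d ^ n) i k = if i = k - n then 1 else 0 := by
  induction n generalizing i k with
  | zero => simp [Matrix.one_apply]
  | succ n ih =>
    rw [pow_succ, Matrix.mul_apply, Finset.sum_eq_single (k - 1)]
    · rw [ih]; simp [opX, sub_sub, add_comm]
    · intro b _ hb; simp [opX, hb]
    · simp

lemma opZ_pow (n : ℕ) : opZ d ^ n = Matrix.diagonal fun k => om d (n * k) := by
  rw [opZ, Matrix.diagonal_pow]
  congr 1; ext k; simp [om_nsmul]

lemma errOp_apply (e : Err d) (i k : ZMod d) :
    errOp e i k = if i = e.2.2 * k - e.1 then om d (e.2.1 * (e.2.2 * k)) else 0 := by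
  rw [errOp, opZ_pow, Matrix.mul_apply, Finset.sum_eq_single ((e.2.2 : ZMod d) * k)]
  · rw [Matrix.mul_diagonal, opX_pow_apply]
    simp [opS]
  · intro b _ hb; simp [opS, hb]
  · simp

lemma mul_errOp_apply (M : Op d) (e : Err d) (i k : ZMod d) :
    (M * errOp e) i k = M i (e.2.2 * k - e.1) * om d (e.2.1 * (e.2.2 * k)) := by
  rw [Matrix.mul_apply, Finset.sum_eq_single ((e.2.2 : ZMod d) * k - e.1)]
  · rw [errOp_apply, if_pos rfl]
  · intro b _ hb; rw [errOp_apply, if_neg hb, mul_zero]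
  · simp

lemma errOp_mul_apply (M : Op d) (e : Err d) (i k : ZMod d) :
    (errOp e * M) i k = om d (e.2.1 * (i + e.1)) * M (((e.2.2)⁻¹ : (ZMod d)ˣ) * (i + e.1)) k := by
  rw [Matrix.mul_apply, Finset.sum_eq_single ((((e.2.2)⁻¹ : (ZMod d)ˣ) : ZMod d) * (i + e.1))]
  · rw [errOp_apply, Units.mul_inv_cancel_left, if_pos (by ring)]
  · intro b _ hb; rw [errOp_apply, if_neg, zero_mul]
    rintro rfl
    apply hb
    simp
  · simp

lemma opX_pow_mul_apply (n : ℕ) (M : Op d) (i k : ZMod d) :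
    (opX d ^ n * M) i k = M (i + n) k := by
  rw [Matrix.mul_apply, Finset.sum_eq_single (i + (n : ZMod d))]
  · rw [opX_pow_apply, if_pos (by ring), one_mul]
  · intro b _ hb; rw [opX_pow_apply, if_neg, zero_mul]
    rintro rfl
    apply hb; ring
  · simp

/-! ### Errors propagate through the gates -/

/-- An error permutes the computational basis up to phases, so it passes a diagonal gate once the
phases are relabelled by that permutation. This is what adaptivity compensates for. -/
lemma phase_mul_errOp (b : ZMod d → ℝ) (e : Err d) :
    phase d (fun i => b (((e.2.2)⁻¹ : (ZMod d)ˣ) * (i + e.1))) * errOp e = errOp e * phase d b := by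
  ext i k
  rw [phase, phase, Matrix.diagonal_mul, Matrix.mul_diagonal, errOp_apply]
  split_ifs with h
  · subst h
    rw [sub_add_cancel, Units.inv_mul_cancel_left]
    ring
  · simp

lemma errOp_mul_errOp (e e' : Err d) :
    ∃ (f : Err d) (θ : ℂ), ‖θ‖ = 1 ∧ errOp e * errOp e' = θ • errOp f := by
  obtain ⟨x, z, c⟩ := e
  obtain ⟨x', z', c'⟩ := e'
  refine ⟨(c * x' + x, z' * (c⁻¹ : (ZMod d)ˣ) + z, c * c'), om d (-(z * c * x')), norm_om _, ?_⟩
  ext i k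
  rw [mul_errOp_apply, errOp_apply, Matrix.smul_apply, errOp_apply]
  simp only [Units.val_mul]
  by_cases h : i = c * (c' * k - x') - x
  · rw [if_pos h, if_pos (by rw [h]; ring), smul_eq_mul, ← om_add, ← om_add]
    congr 1
    have := Units.inv_mul c
    linear_combination (-z' * c' * k) * this
  · rw [if_neg h, if_neg (by rintro rfl; apply h; ring)]
    simp

/-- The Fourier transform turns shifts into clocks and clocks into shifts, and inverts dilations;
the outcome `m` only adds to the shift. -/
lemma opX_pow_mul_opF_mul_errOp (m : ZMod d) (e : Err d) :
    ∃ (f : Err d) (θ : ℂ), ‖θ‖ = 1 ∧ opX d ^ m.val * (opF d * errOp e) = θ • (errOp f * opF d) := by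
  obtain ⟨x, z, c⟩ := e
  refine ⟨(m + z, -x, c⁻¹), om d (x * z), norm_om _, ?_⟩
  ext y k
  rw [opX_pow_mul_apply, mul_errOp_apply, Matrix.smul_apply, errOp_mul_apply, opF_apply, opF_apply,
    smul_eq_mul, mul_assoc, ← om_add, mul_left_comm (om d (x * z)),
    mul_left_comm _ (((Real.sqrt d : ℝ) : ℂ)⁻¹), ← om_add,
    mul_left_comm _ (((Real.sqrt d : ℝ) : ℂ)⁻¹), ← om_add]
  congr 2
  simp
  ring

/-- `F²` is the reflection `k ↦ -k`, itself an admissible error, so `F` may be traded for its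
inverse. -/
lemma opF_eq : opF d = errOp (0, 0, -1) * (opF d)ᴴ := by
  ext i k
  rw [errOp_mul_apply]
  simp [Matrix.conjTranspose_apply, opF_apply, om_zero, ← om_neg, -RCLike.star_def, mul_comm]

lemma opF_mul_conjTranspose : opF d * (opF d)ᴴ = 1 := by
  ext i k
  simp only [Matrix.mul_apply, Matrix.conjTranspose_apply, opF_apply, star_mul, star_sqrt_inv,
    ← om_neg]
  have : ∀ j : ZMod d, ((Real.sqrt d : ℝ) : ℂ)⁻¹ * om d (i * j) *
      (om d (-(k * j)) * ((Real.sqrt d : ℝ) : ℂ)⁻¹) = (d : ℂ)⁻¹ * om d (j * (i - k)) := by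
    intro j
    rw [mul_comm (om d (-(k * j))), mul_mul_mul_comm, sqrt_inv_sq, ← om_add]
    congr 2; ring
  rw [Finset.sum_congr rfl fun j _ => this j, ← Finset.mul_sum, sum_om_mul, Matrix.one_apply]
  by_cases h : i = k
  · simp [h, NeZero.ne d]
  · simp [h, sub_eq_zero]

lemma conjTranspose_mul_opF : (opF d)ᴴ * opF d = 1 :=
  mul_eq_one_comm.mp opF_mul_conjTranspose

lemma phase_zero : phase d 0 = 1 := by simp [phase]

lemma phase_mul_phase (a b : ZMod d → ℝ) : phase d a * phase d b = phase d (a + b) := by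
  simp [phase, ← Complex.exp_add, mul_add]

lemma conjTranspose_phase (a : ZMod d → ℝ) : (phase d a)ᴴ = phase d (-a) := by
  rw [phase, Matrix.diagonal_conjTranspose, phase]
  congr 1; ext k
  simp [← Complex.exp_conj]

/-! ### Sequences of teleportations -/

/-- `Tel n B C`: by `n` adaptive one-dit teleportations the operator `B` can be completed
to the operator `C`, up to errors and global phases. -/
def Tel : ℕ → Op d → Op d → Prop
  | 0, B, C => ∃ (e : Err d) (θ : ℂ), ‖θ‖ = 1 ∧ B = θ • (errOp e * C)
  | n + 1, B, C => ∃ a : ZMod d → ℝ, ∀ m : ZMod d,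
      Tel n (opX d ^ m.val * (opF d * phase d a) * B) C

lemma Tel.smul {n : ℕ} {B C : Op d} (h : Tel n B C) {θ : ℂ} (hθ : ‖θ‖ = 1) :
    Tel n (θ • B) C := by
  induction n generalizing B with
  | zero =>
    obtain ⟨e, η, hη, rfl⟩ := h
    exact ⟨e, θ * η, by simp [hθ, hη], by rw [smul_smul]⟩
  | succ n ih =>
    obtain ⟨a, ha⟩ := h
    exact ⟨a, fun m => by rw [Matrix.mul_smul]; exact ih (ha m)⟩

lemma Tel.mul_right {n : ℕ} {B C : Op d} (h : Tel n B C) (D : Op d) :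
    Tel n (B * D) (C * D) := by
  induction n generalizing B with
  | zero =>
    obtain ⟨e, η, hη, rfl⟩ := h
    exact ⟨e, η, hη, by rw [Matrix.smul_mul, Matrix.mul_assoc]⟩
  | succ n ih =>
    obtain ⟨a, ha⟩ := h
    exact ⟨a, fun m => by rw [← Matrix.mul_assoc]; exact ih (ha m)⟩

/-- The count is `k + n`, in this order, so that it unfolds definitionally in the induction on `n`.
-/
lemma Tel.trans {n k : ℕ} {B C D : Op d} (h : Tel n B C)
    (h' : ∀ e : Err d, Tel k (errOp e * C) D) : Tel (k + n) B D := by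
  induction n generalizing B with
  | zero =>
    obtain ⟨e, θ, hθ, rfl⟩ := h
    exact (h' e).smul hθ
  | succ n ih =>
    obtain ⟨a, ha⟩ := h
    exact ⟨a, fun m => ih (ha m)⟩

lemma Tel.of_errOp_mul {n : ℕ} {B C : Op d} {e : Err d} (h : Tel n B (errOp e * C)) :
    Tel n B C := by
  induction n generalizing B with
  | zero =>
    obtain ⟨e', θ, hθ, rfl⟩ := h
    obtain ⟨f, η, hη, h⟩ := errOp_mul_errOp e' e
    refine ⟨f, θ * η, by simp [hθ, hη], ?_⟩
    rw [← Matrix.mul_assoc, h, Matrix.smul_mul, smul_smul]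
  | succ n ih =>
    obtain ⟨a, ha⟩ := h
    exact ⟨a, fun m => ih (ha m)⟩

lemma tel_mul {n k : ℕ} {G H : Op d} (hG : ∀ e : Err d, Tel n (errOp e) G)
    (hH : ∀ e : Err d, Tel k (errOp e) H) (e : Err d) : Tel (k + n) (errOp e) (H * G) :=
  (hG e).trans fun e' => (hH e').mul_right G

lemma tel_opF_mul_phase (b : ZMod d → ℝ) (e : Err d) :
    Tel 1 (errOp e) (opF d * phase d b) := by
  refine ⟨fun i => b (((e.2.2)⁻¹ : (ZMod d)ˣ) * (i + e.1)), fun m => ?_⟩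
  rw [Matrix.mul_assoc, Matrix.mul_assoc, phase_mul_errOp b e, ← Matrix.mul_assoc (opF d),
    ← Matrix.mul_assoc]
  obtain ⟨f, θ, hθ, h⟩ := opX_pow_mul_opF_mul_errOp m e
  exact ⟨f, θ, hθ, by rw [h, Matrix.smul_mul, Matrix.mul_assoc]⟩

lemma tel_conj (b a : ZMod d → ℝ) (e : Err d) :
    Tel 2 (errOp e) ((opF d)ᴴ * phase d b * opF d * phase d a) := by
  have h := tel_mul (tel_opF_mul_phase a) (tel_opF_mul_phase b) e
  refine Tel.of_errOp_mul (e := (0, 0, -1)) ?_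
  simp only [← Matrix.mul_assoc] at h ⊢
  rwa [← opF_eq]

/-! ### The linear cluster -/

lemma ketPlus_zero_apply (k : ZMod d) : ketPlus d 0 k = ((Real.sqrt d : ℝ) : ℂ)⁻¹ := by
  simp [ketPlus, om_zero]

lemma star_measVec (a : ZMod d → ℝ) (m x : ZMod d) :
    star (measVec a m x) = (opF d * phase d a) m x := by
  simp [measVec, Matrix.conjTranspose_apply]

lemma residual_smul (n : ℕ) (A : Pattern d n) (m : Fin n → ZMod d) (c : ℂ) (ψ : ZMod d → ℂ) :
    residual n A m (c • ψ) = c • residual n A m ψ := by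
  ext y
  simp only [residual, clusterState, Pi.smul_apply, smul_eq_mul, Finset.mul_sum]
  refine Finset.sum_congr rfl fun x _ => ?_
  ring

/-- The pattern that remains after the first outcome is known. -/
def Pattern.tail {n : ℕ} (A : Pattern d (n + 1)) (m₀ : ZMod d) : Pattern d n :=
  fun i p => A i.succ (Fin.cons (α := fun _ => ZMod d) m₀ p)

/-- The controlled-`Z` phase `ω^(x₀ l)` turns row `m₀` of `F Z(a)` into row `l + m₀`, which is row
`l` of `X^m₀ F Z(a)`; the amplitude of `|+_0⟩` is the factor `d^(-1/2)`. Qudit 1 then plays the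
input of the remaining cluster. -/
lemma residual_succ (n : ℕ) (A : Pattern d (n + 1)) (m : Fin (n + 1) → ZMod d)
    (ψ : ZMod d → ℂ) :
    residual (n + 1) A m ψ = residual n (A.tail (m 0)) (Fin.tail m)
      (((Real.sqrt d : ℝ) : ℂ)⁻¹ •
        ((opX d ^ (m 0).val * (opF d * phase d
          (A 0 fun j => m (j.castLE (0 : Fin (n + 1)).isLt.le)))) *ᵥ ψ)) := by
  ext y
  rw [residual, ← (Fin.consEquiv fun _ => ZMod d).sum_comp, Fintype.sum_prod_type,
    Finset.sum_comm, residual]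
  refine Finset.sum_congr rfl fun x _ => ?_
  have hstep : ∀ l : ZMod d, (((Real.sqrt d : ℝ) : ℂ)⁻¹ •
      ((opX d ^ (m 0).val * (opF d * phase d
          (A 0 fun j => m (j.castLE (0 : Fin (n + 1)).isLt.le)))) *ᵥ ψ)) l =
      ∑ x₀, ((opF d * phase d (A 0 fun j => m (j.castLE (0 : Fin (n + 1)).isLt.le))) (m 0) x₀ *
        (om d (x₀ * l) * (((Real.sqrt d : ℝ) : ℂ)⁻¹ * ψ x₀))) := by
    intro l
    rw [Pi.smul_apply, Matrix.mulVec, dotProduct, smul_eq_mul, Finset.mul_sum]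
    refine Finset.sum_congr rfl fun x₀ _ => ?_
    rw [opX_pow_mul_apply, phase, Matrix.mul_diagonal, Matrix.mul_diagonal, opF_apply, opF_apply,
      ZMod.natCast_zmod_val, add_mul, om_add, mul_comm x₀ l]
    ring
  rw [clusterState, hstep]
  simp only [Finset.sum_mul, Finset.mul_sum]
  refine Finset.sum_congr rfl fun x₀ _ => ?_
  have hcons : (Fin.consEquiv fun _ : Fin (n + 1) => ZMod d) (x₀, x) =
      Fin.cons (α := fun _ => ZMod d) x₀ x := rfl
  rw [hcons, Fin.prod_univ_succ, clusterState, ← Fin.cons_snoc_eq_snoc_cons, Fin.prod_univ_succ]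
  simp only [Fin.cons_zero, Fin.cons_succ, Fin.castSucc_zero, star_measVec, Fin.succ_zero_eq_one,
    Fin.cons_one, ketPlus_zero_apply, Finset.prod_const, Finset.card_univ, Fintype.card_fin, pow_succ,
    ← Fin.succ_castSucc]
  have h2 : ∀ i : Fin n, (fun j : Fin (i.succ : ℕ) => m (j.castLE i.succ.isLt.le)) =
      Fin.cons (α := fun _ => ZMod d) (m 0) fun j : Fin i => Fin.tail m (j.castLE i.isLt.le) := by
    intro i
    funext j
    refine Fin.cases rfl (fun j => rfl) j
  simp only [h2, Pattern.tail, Fin.tail]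
  ring

lemma Tel.exists_pattern {n : ℕ} {B C : Op d} (h : Tel n B C) :
    ∃ A : Pattern d n, ∀ m : Fin n → ZMod d, ∃ (e : Err d) (θ : ℂ), ‖θ‖ = 1 ∧
      ∀ ψ : ZMod d → ℂ, residual n A m (B *ᵥ ψ) =
        (((Real.sqrt d : ℝ) : ℂ)⁻¹ ^ n * θ) • (errOp e *ᵥ (C *ᵥ ψ)) := by
  induction n generalizing B with
  | zero =>
    obtain ⟨e, θ, hθ, rfl⟩ := h
    refine ⟨fun i => i.elim0, fun m => ⟨e, θ, hθ, fun ψ => ?_⟩⟩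
    have : ∀ φ : ZMod d → ℂ, residual 0 (fun i => i.elim0) m φ = φ := by
      intro φ; ext y
      simp [residual, clusterState, Fin.snoc]
    rw [this, Matrix.smul_mulVec, pow_zero, one_mul, Matrix.mulVec_mulVec]
  | succ n ih =>
    obtain ⟨a, ha⟩ := h
    choose A hA using fun m => ih (ha m)
    -- Qudit 0 uses `a`; each later qudit reads the first outcome `p 0` and follows the pattern
    -- chosen for it, with the other outcomes shifted by one.
    refine ⟨fun i => Fin.cases (motive := fun i : Fin (n + 1) => (Fin i → ZMod d) → ZMod d → ℝ)
      (fun _ => a) (fun j p => A (p ⟨0, Nat.succ_pos _⟩) j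
        (fun t => p ⟨t + 1, Nat.succ_lt_succ t.isLt⟩)) i, fun m => ?_⟩
    obtain ⟨e, θ, hθ, h⟩ := hA (m 0) (Fin.tail m)
    refine ⟨e, θ, hθ, fun ψ => ?_⟩
    rw [residual_succ, residual_smul, Matrix.mulVec_mulVec, pow_succ',
      mul_assoc ((Real.sqrt d : ℝ) : ℂ)⁻¹, ← smul_smul, ← h ψ]
    rfl

lemma implements_of_tel {n : ℕ} {G : Op d} (h : ∀ e : Err d, Tel n (errOp e) G) :
    Implements n G := by
  intro e
  obtain ⟨A, hA⟩ := (h e).exists_pattern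
  choose f hf using hA
  exact ⟨A, f, hf⟩

/-! ### Eigenvectors of inner product preserving maps -/

section Eigen

variable {E : Type*} [NormedAddCommGroup E] [InnerProductSpace ℂ E] {f g : E →ₗ[ℂ] E}

lemma norm_eigenvalue (hf : ∀ x y, inner ℂ (f x) (f y) = inner ℂ x y) {v : E} {μ : ℂ}
    (hv : f v = μ • v) (hv0 : v ≠ 0) : ‖μ‖ = 1 := by
  have h := hf v v
  rw [hv, inner_smul_left, inner_smul_right, ← mul_assoc, RCLike.conj_mul] at h
  have h0 : inner ℂ v v ≠ 0 := inner_self_ne_zero.mpr hv0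
  have h1 := mul_right_cancel₀ h0 (h.trans (one_mul _).symm)
  have h2 : ‖μ‖ ^ 2 = 1 := by
    rw [← Complex.ofReal_inj]
    simpa using h1
  exact (pow_eq_one_iff_of_nonneg (norm_nonneg _) two_ne_zero).mp h2

lemma inner_eigenvectors (hf : ∀ x y, inner ℂ (f x) (f y) = inner ℂ x y) {v w : E} {μ ν : ℂ}
    (hv : f v = μ • v) (hw : f w = ν • w) (h : μ ≠ ν) : inner ℂ v w = 0 := by
  by_contra h0
  have hv0 : v ≠ 0 := by rintro rfl; simp at h0
  have h1 := hf v w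
  rw [hv, hw, inner_smul_left, inner_smul_right, ← mul_assoc] at h1
  have h2 := mul_right_cancel₀ h0 (h1.trans (one_mul _).symm)
  have h3 : (starRingEnd ℂ) μ * μ = 1 := by
    rw [RCLike.conj_mul, norm_eigenvalue hf hv hv0]; simp
  have h4 : (starRingEnd ℂ) μ ≠ 0 := left_ne_zero_of_mul_eq_one h3
  exact h (mul_left_cancel₀ h4 (h3.trans h2.symm))

lemma apply_pow_eigenvector {ζ μ : ℂ} (hfg : ∀ x, f (g x) = ζ • g (f x)) {v : E}
    (hv : f v = μ • v) (n : ℕ) : f ((g ^ n) v) = (ζ ^ n * μ) • (g ^ n) v := by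
  induction n with
  | zero => simpa using hv
  | succ n ih =>
    rw [pow_succ', Module.End.mul_apply, hfg, ih, map_smul, smul_smul, pow_succ', mul_assoc]

lemma norm_pow_apply (hg : ∀ x y, inner ℂ (g x) (g y) = inner ℂ x y) (v : E) (n : ℕ) :
    ‖(g ^ n) v‖ = ‖v‖ := by
  induction n with
  | zero => simp
  | succ n ih =>
    rw [pow_succ', Module.End.mul_apply, @norm_eq_sqrt_re_inner ℂ, hg, ← @norm_eq_sqrt_re_inner ℂ,
      ih]

/-- Each application of `g` multiplies the `f`-eigenvalue by `ζ`, so the orbit has distinct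
eigenvalues and is orthogonal. -/
lemma orthonormal_orbit (hf : ∀ x y, inner ℂ (f x) (f y) = inner ℂ x y)
    (hg : ∀ x y, inner ℂ (g x) (g y) = inner ℂ x y) {ζ μ : ℂ}
    (hfg : ∀ x, f (g x) = ζ • g (f x)) (hζ : Function.Injective fun t : ZMod d => ζ ^ t.val)
    {v : E} (hv : f v = μ • v) (hv1 : ‖v‖ = 1) :
    Orthonormal ℂ fun t : ZMod d => (g ^ t.val) v := by
  have hμ : μ ≠ 0 := by
    have := norm_eigenvalue hf hv (by rintro rfl; simp at hv1)
    rintro rfl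
    simp at this
  refine ⟨fun t => by rw [norm_pow_apply hg, hv1], fun s t hst => ?_⟩
  exact inner_eigenvectors hf (apply_pow_eigenvector hfg hv _) (apply_pow_eigenvector hfg hv _)
    fun h => hst (hζ (mul_right_cancel₀ hμ h))

end Eigen

/-- An orthonormal family of `d` vectors as an orthonormal basis. -/
def onb {v : ZMod d → Ket d} (hv : Orthonormal ℂ v) : OrthonormalBasis (ZMod d) ℂ (Ket d) :=
  OrthonormalBasis.mk hv (hv.linearIndependent.span_eq_top_of_card_eq_finrank' (by simp)).ge

lemma onb_apply {v : ZMod d → Ket d} (hv : Orthonormal ℂ v) (j : ZMod d) : onb hv j = v j := by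
  simp [onb]

/-- The `g`-orbit of `v` is an orthonormal basis, and since `w` is an eigenvector of `g` its `d`
coefficients there have equal modulus; Parseval fixes the value. -/
lemma norm_inner_eigenvectors {f g : Ket d →ₗ[ℂ] Ket d}
    (hf : ∀ x y, inner ℂ (f x) (f y) = inner ℂ x y)
    (hg : ∀ x y, inner ℂ (g x) (g y) = inner ℂ x y) {ζ μ ν : ℂ}
    (hfg : ∀ x, f (g x) = ζ • g (f x)) (hζ : Function.Injective fun t : ZMod d => ζ ^ t.val)
    {v w : Ket d} (hv : f v = μ • v) (hv1 : ‖v‖ = 1) (hw : g w = ν • w) (hw1 : ‖w‖ = 1) :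
    ‖inner ℂ v w‖ = 1 / Real.sqrt d := by
  have hν : ‖ν‖ = 1 := norm_eigenvalue hg hw (by rintro rfl; simp at hw1)
  have hstep : ∀ n : ℕ, ‖inner ℂ ((g ^ n) v) w‖ = ‖inner ℂ v w‖ := by
    intro n
    induction n with
    | zero => simp
    | succ n ih =>
      rw [← ih, ← hg ((g ^ n) v) w, hw, inner_smul_right, norm_mul, hν, one_mul, pow_succ',
        Module.End.mul_apply]
  have hsum := (onb (orthonormal_orbit hf hg hfg hζ hv hv1)).sum_sq_norm_inner_right w
  simp only [onb_apply, hstep, hw1, Finset.sum_const, Finset.card_univ, ZMod.card,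
    nsmul_eq_mul, one_pow] at hsum
  have hd : (0 : ℝ) < d := by exact_mod_cast Nat.pos_of_ne_zero (NeZero.ne d)
  rw [eq_div_iff (Real.sqrt_pos.mpr hd).ne', ← Real.sqrt_sq (norm_nonneg (inner ℂ v w)),
    ← Real.sqrt_mul (sq_nonneg _), mul_comm, hsum, Real.sqrt_one]

/-! ### The unitary operators `X` and `Z X ^ k` -/

lemma opX_mem : opX d ∈ Matrix.unitaryGroup (ZMod d) ℂ := by
  rw [Matrix.mem_unitaryGroup_iff']
  ext i k
  simp [Matrix.mul_apply, Matrix.star_eq_conjTranspose, Matrix.conjTranspose_apply, opX,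
    Matrix.one_apply, eq_comm]

lemma opZ_mem : opZ d ∈ Matrix.unitaryGroup (ZMod d) ℂ := by
  rw [Matrix.mem_unitaryGroup_iff', Matrix.star_eq_conjTranspose, opZ,
    Matrix.diagonal_conjTranspose, Matrix.diagonal_mul_diagonal]
  simp only [Pi.star_apply, star_mul_om, Matrix.diagonal_one]

lemma mubOp_mem (i : Option (ZMod d)) : mubOp d i ∈ Matrix.unitaryGroup (ZMod d) ℂ := by
  cases i with
  | none => exact opX_mem
  | some k => exact mul_mem opZ_mem (pow_mem opX_mem _)

lemma opX_pow_mul_opZ (n : ℕ) : opX d ^ n * opZ d = om d n • (opZ d * opX d ^ n) := by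
  ext i k
  rw [opX_pow_mul_apply, opZ, Matrix.smul_apply, Matrix.diagonal_mul, opX_pow_apply,
    Matrix.diagonal_apply]
  by_cases h : i = k - n
  · subst h; simp [← om_add]
  · rw [if_neg, if_neg h]
    · simp
    · rintro rfl; apply h; ring

/-- From `X^n Z = ω^n Z X^n`: the commutation factor of `Z X^k` and `Z X^l` is `ω^(k - l)`. -/
lemma mubOp_commute {d : ℕ} [Fact d.Prime] {i i' : Option (ZMod d)} (h : i ≠ i') :
    ∃ κ : ZMod d, κ ≠ 0 ∧ mubOp d i * mubOp d i' = om d κ • (mubOp d i' * mubOp d i) := by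
  have key : ∀ k l : ZMod d, opZ d * opX d ^ k.val * (opZ d * opX d ^ l.val) =
      om d k • (opZ d * opZ d * opX d ^ (k.val + l.val)) := by
    intro k l
    rw [Matrix.mul_assoc, ← Matrix.mul_assoc (opX d ^ k.val), opX_pow_mul_opZ,
      ZMod.natCast_zmod_val, Matrix.smul_mul, Matrix.mul_smul, pow_add]
    simp only [Matrix.mul_assoc]
  have key' : ∀ k : ZMod d, opX d * (opZ d * opX d ^ k.val) =
      om d 1 • (opZ d * opX d ^ k.val * opX d) := by
    intro k
    have := opX_pow_mul_opZ (d := d) 1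
    rw [pow_one, Nat.cast_one] at this
    rw [← Matrix.mul_assoc, this, Matrix.smul_mul, Matrix.mul_assoc, Matrix.mul_assoc, ← pow_succ,
      ← pow_succ']
  have h1 : (1 : ZMod d) ≠ 0 := one_ne_zero
  match i, i' with
  | none, none => exact absurd rfl h
  | none, some k => exact ⟨1, h1, key' k⟩
  | some k, none =>
    refine ⟨-1, neg_ne_zero.mpr h1, ?_⟩
    change _ = om d (-1) • (opX d * (opZ d * opX d ^ k.val))
    rw [key', smul_smul, ← om_add, neg_add_cancel, om_zero, one_smul]
    rfl
  | some k, some l =>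
    refine ⟨k - l, sub_ne_zero.mpr fun hkl => h (by rw [hkl]), ?_⟩
    simp only [mubOp]
    rw [key, key, smul_smul, ← om_add, sub_add_cancel, add_comm]

lemma ofLp_toEuclideanLin (U : Op d) (v : Ket d) :
    (Matrix.toEuclideanLin U v).ofLp = U *ᵥ v.ofLp := rfl

lemma inner_toEuclideanLin {U : Op d} (hU : U ∈ Matrix.unitaryGroup (ZMod d) ℂ) (x y : Ket d) :
    inner ℂ (Matrix.toEuclideanLin U x) (Matrix.toEuclideanLin U y) = inner ℂ x y := by
  rw [← LinearMap.adjoint_inner_right, ← Matrix.toEuclideanLin_conjTranspose_eq_adjoint]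
  congr 1
  ext i
  simp only [ofLp_toEuclideanLin, Matrix.mulVec_mulVec]
  rw [← Matrix.star_eq_conjTranspose, Matrix.mem_unitaryGroup_iff'.mp hU, Matrix.one_mulVec]

lemma toEuclideanLin_commute {U V : Op d} {ζ : ℂ} (h : U * V = ζ • (V * U)) (x : Ket d) :
    Matrix.toEuclideanLin U (Matrix.toEuclideanLin V x) =
      ζ • Matrix.toEuclideanLin V (Matrix.toEuclideanLin U x) := by
  ext i
  simp only [ofLp_toEuclideanLin, Matrix.mulVec_mulVec, h, Matrix.smul_mulVec,
    PiLp.smul_apply, Pi.smul_apply]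

/-! ### Orthonormal families as columns of unitary matrices -/

/-- The columns of a matrix. -/
def colVec (W : Op d) (t : ZMod d) : Ket d := WithLp.toLp 2 fun x => W x t

lemma inner_colVec (W : Op d) (s t : ZMod d) : inner ℂ (colVec W s) (colVec W t) = (Wᴴ * W) s t := by
  simp [colVec, PiLp.inner_apply, Matrix.mul_apply, mul_comm]

lemma orthonormal_colVec {W : Op d} (hW : Wᴴ * W = 1) : Orthonormal ℂ (colVec W) := by
  rw [orthonormal_iff_ite]
  intro s t
  rw [inner_colVec, hW, Matrix.one_apply]

lemma exists_colVec {v : ZMod d → Ket d} (hv : Orthonormal ℂ v) :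
    ∃ W : Op d, Wᴴ * W = 1 ∧ v = colVec W := by
  refine ⟨Matrix.of fun x j => v j x, ?_, rfl⟩
  ext s t
  rw [← inner_colVec, Matrix.one_apply]
  exact orthonormal_iff_ite.mp hv s t

lemma sum_smul_proj_colVec (W : Op d) (f : ZMod d → ℂ) :
    ∑ j, f j • proj (colVec W j) = W * Matrix.diagonal f * Wᴴ := by
  ext x y
  rw [Matrix.sum_apply, Matrix.mul_apply]
  refine Finset.sum_congr rfl fun j _ => ?_
  rw [Matrix.mul_diagonal, Matrix.conjTranspose_apply]
  simp only [proj, colVec, Matrix.smul_apply, Matrix.of_apply, smul_eq_mul]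
  ring

lemma gate_colVec (W : Op d) (a : ZMod d → ℝ) : gate (colVec W) a = W * phase d a * Wᴴ :=
  sum_smul_proj_colVec W _

lemma ket_eq_colVec : ket d = colVec (1 : Op d) := by
  ext k x
  simp [ket, colVec, Matrix.one_apply]

lemma ketPlus_eq_colVec : ketPlus d = colVec (opF d) := by
  ext k x
  simp [ketPlus, colVec, opF_apply, mul_comm]

lemma hasEigenvector_iff {U : Op d} {μ : ℂ} {v : Ket d} :
    Module.End.HasEigenvector (Matrix.toEuclideanLin U) μ v ↔
      U *ᵥ v.ofLp = μ • v.ofLp ∧ v ≠ 0 := by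
  rw [Module.End.hasEigenvector_iff, Module.End.mem_eigenspace_iff]
  refine and_congr_left fun _ => ⟨fun h => congrArg WithLp.ofLp h, fun h => ?_⟩
  ext i
  exact congrFun h i

lemma Orthonormal.isEigenbasis {U : Op d} {v : ZMod d → Ket d} (hv : Orthonormal ℂ v)
    {μ : ZMod d → ℂ} (h : ∀ j, Matrix.toEuclideanLin U (v j) = μ j • v j) : IsEigenbasis U v :=
  ⟨hv, fun j => ⟨μ j, Module.End.hasEigenvector_iff.mpr
    ⟨Module.End.mem_eigenspace_iff.mpr (h j), hv.ne_zero j⟩⟩⟩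

/-- An eigenbasis for pairwise distinct eigenvalues is unique up to order and phases, so that the
gates attached to it are the same up to reordering the phases. -/
lemma IsEigenbasis.exists_gate_eq {U : Op d} {v w : ZMod d → Ket d} (hv : IsEigenbasis U v)
    (hw : Orthonormal ℂ w) {μ : ZMod d → ℂ} (hμ : Function.Injective μ)
    (h : ∀ t, Matrix.toEuclideanLin U (w t) = μ t • w t) :
    ∃ σ : Equiv.Perm (ZMod d), ∀ a, gate v a = gate w (a ∘ σ) := by
  have key : ∀ j, ∃ i, ∃ c : ℂ, v j = c • w i := by
    intro j
    obtain ⟨ν, hν⟩ := hv.2 j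
    have hsum : ∀ x, ∑ i, inner ℂ (w i) x • w i = x := by
      intro x
      simpa only [onb_apply] using (onb hw).sum_repr' x
    -- Comparing coefficients of `U (v j)` in the basis `w`: a nonzero coefficient forces `μ i = ν`,
    -- so by injectivity only one survives.
    have hcoef : ∀ i, μ i * inner ℂ (w i) (v j) = ν * inner ℂ (w i) (v j) := by
      intro i
      have h1 : ν • v j = ∑ i, (inner ℂ (w i) (v j) * μ i) • w i := by
        rw [← hν.apply_eq_smul]
        conv_lhs => rw [← hsum (v j), map_sum]
        simp only [map_smul, h, smul_smul]
      have h2 := congrArg (inner ℂ (w i)) h1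
      rw [hw.inner_right_fintype, inner_smul_right] at h2
      rw [h2, mul_comm]
    obtain ⟨i, hi⟩ : ∃ i, inner ℂ (w i) (v j) ≠ 0 := by
      by_contra! h0
      apply hv.1.ne_zero j
      rw [← hsum (v j)]
      simp [h0]
    refine ⟨i, inner ℂ (w i) (v j), ?_⟩
    conv_lhs => rw [← hsum (v j)]
    refine Finset.sum_eq_single i (fun k _ hk => ?_) (by simp)
    have : inner ℂ (w k) (v j) = 0 := by
      by_contra h0
      exact hk (hμ ((mul_right_cancel₀ h0 (hcoef k)).trans
        (mul_right_cancel₀ hi (hcoef i)).symm))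
    rw [this, zero_smul]
  choose σ c hσ using key
  have hc : ∀ j, ‖c j‖ = 1 := by
    intro j
    have := congrArg norm (hσ j)
    rw [norm_smul, hv.1.1, hw.1, mul_one] at this
    exact this.symm
  have hinj : Function.Injective σ := by
    intro j k hjk
    by_contra hne
    have : inner ℂ (v j) (v k) = 0 := hv.1.2 hne
    rw [hσ j, hσ k, hjk, inner_smul_left, inner_smul_right, inner_self_eq_norm_sq_to_K, hw.1] at this
    have hj := hc j
    have hk := hc k
    simp at this
    rcases this with h0 | h0 <;> simp [h0] at hj hk
  let e : Equiv.Perm (ZMod d) := Equiv.ofBijective σ (Finite.injective_iff_bijective.mp hinj)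
  refine ⟨e.symm, fun a => ?_⟩
  rw [gate, gate,
    ← Equiv.sum_comp e fun j => Complex.exp (Complex.I * ((a ∘ e.symm) j : ℂ)) • proj (w j)]
  refine Finset.sum_congr rfl fun j _ => ?_
  have hp : proj (v j) = proj (w (e j)) := by
    ext x y
    have : c j * star (c j) = 1 := by
      simpa [hc j] using RCLike.mul_conj (c j)
    change v j x * star (v j y) = w (σ j) x * star (w (σ j) y)
    rw [hσ j]
    simp only [PiLp.smul_apply, smul_eq_mul, star_mul]
    linear_combination (w (σ j) x * star (w (σ j) y)) * this
  simp [hp]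

/-! ### The eigenbases of the operators -/

lemma opZ_ket (j : ZMod d) : Matrix.toEuclideanLin (opZ d) (ket d j) = om d j • ket d j := by
  ext x
  rw [ofLp_toEuclideanLin, opZ, Matrix.mulVec_diagonal]
  by_cases h : x = j
  · subst h; simp [ket]
  · simp [ket, h]

lemma opX_pow_mulVec (n : ℕ) (φ : ZMod d → ℂ) (x : ZMod d) :
    (opX d ^ n *ᵥ φ) x = φ (x + n) := by
  rw [Matrix.mulVec, dotProduct, Finset.sum_eq_single (x + n)]
  · rw [opX_pow_apply, if_pos (by ring), one_mul]
  · intro b _ hb; rw [opX_pow_apply, if_neg, zero_mul]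
    rintro rfl
    apply hb; ring
  · simp

lemma opX_ketPlus (j : ZMod d) :
    Matrix.toEuclideanLin (opX d) (ketPlus d j) = om d j • ketPlus d j := by
  ext x
  have := opX_pow_mulVec 1 (ketPlus d j).ofLp x
  rw [pow_one] at this
  rw [ofLp_toEuclideanLin, this]
  simp only [ketPlus, PiLp.smul_apply, smul_eq_mul, Nat.cast_one, mul_add, mul_one, om_add]
  ring

lemma isEigenbasis_ket : IsEigenbasis (opZ d) (ket d) :=
  Orthonormal.isEigenbasis (by rw [ket_eq_colVec]; exact orthonormal_colVec (by simp)) opZ_ket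

lemma isEigenbasis_ketPlus : IsEigenbasis (opX d) (ketPlus d) :=
  Orthonormal.isEigenbasis
    (by rw [ketPlus_eq_colVec]; exact orthonormal_colVec conjTranspose_mul_opF) opX_ketPlus

lemma mubOp_some_zero : mubOp d (some 0) = opZ d := by simp [mubOp]

lemma om_pow_val (κ t : ZMod d) : om d κ ^ t.val = om d (t * κ) := by
  rw [← om_nsmul, ZMod.natCast_zmod_val]

section Prime

variable {d : ℕ} [Fact d.Prime]

lemma injective_om_pow {κ : ZMod d} (hκ : κ ≠ 0) :
    Function.Injective fun t : ZMod d => om d κ ^ t.val := by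
  intro s t h
  simp only [om_pow_val] at h
  exact mul_right_cancel₀ hκ (om_injective h)

lemma exists_isEigenbasis (i : Option (ZMod d)) : ∃ v, IsEigenbasis (mubOp d i) v := by
  obtain ⟨i', hi'⟩ := exists_ne i
  obtain ⟨κ, hκ, hcomm⟩ := mubOp_commute hi'.symm
  obtain ⟨μ, hμ⟩ := Module.End.exists_eigenvalue (Matrix.toEuclideanLin (mubOp d i))
  obtain ⟨v, hv⟩ := hμ.exists_hasEigenvector
  have hv' := hv.apply_eq_smul
  have hu : Matrix.toEuclideanLin (mubOp d i) (((‖v‖ : ℂ)⁻¹) • v) = μ • (((‖v‖ : ℂ)⁻¹) • v) := by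
    rw [map_smul, hv', smul_comm]
  have hu1 : ‖((‖v‖ : ℂ)⁻¹) • v‖ = 1 := by
    rw [norm_smul, norm_inv, Complex.norm_real, norm_norm,
      inv_mul_cancel₀ (norm_ne_zero_iff.mpr hv.2)]
  have hfg := toEuclideanLin_commute hcomm
  exact ⟨_, Orthonormal.isEigenbasis
    (orthonormal_orbit (inner_toEuclideanLin (mubOp_mem i)) (inner_toEuclideanLin (mubOp_mem i'))
      hfg (injective_om_pow hκ) hu hu1)
    fun t => apply_pow_eigenvector hfg hu t.val⟩

lemma mutuallyUnbiased_of_isEigenbasis {i i' : Option (ZMod d)} (h : i ≠ i')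
    {v w : ZMod d → Ket d} (hv : IsEigenbasis (mubOp d i) v) (hw : IsEigenbasis (mubOp d i') w) :
    MutuallyUnbiased v w := by
  intro j k
  obtain ⟨κ, hκ, hcomm⟩ := mubOp_commute h
  obtain ⟨μ, hμ⟩ := hv.2 j
  obtain ⟨ν, hν⟩ := hw.2 k
  exact norm_inner_eigenvectors (inner_toEuclideanLin (mubOp_mem i))
    (inner_toEuclideanLin (mubOp_mem i')) (toEuclideanLin_commute hcomm) (injective_om_pow hκ)
    hμ.apply_eq_smul (hv.1.1 j) hν.apply_eq_smul (hw.1.1 k)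

/-- Unbiasedness with the computational basis makes all entries have modulus `1/√d`. -/
lemma exists_phases {k : ZMod d} (hk : k ≠ 0) {v : ZMod d → Ket d}
    (hv : IsEigenbasis (mubOp d (some k)) v) (j : ZMod d) : ∃ c : ZMod d → ℝ, ∀ x,
      v j x = ((Real.sqrt d : ℝ) : ℂ)⁻¹ * Complex.exp (Complex.I * c x) := by
  refine ⟨fun x => Complex.arg (v j x), fun x => ?_⟩
  have h := mutuallyUnbiased_of_isEigenbasis (i := some 0) (by simpa using hk.symm)
    (by rw [mubOp_some_zero]; exact isEigenbasis_ket) hv x j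
  have h' : ‖v j x‖ = (Real.sqrt d)⁻¹ := by
    simpa [ket, EuclideanSpace.inner_single_left] using h
  conv_lhs => rw [← Complex.norm_mul_exp_arg_mul_I (v j x), h']
  rw [mul_comm Complex.I]
  simp

lemma tel_gate_opZ {v : ZMod d → Ket d} (hv : IsEigenbasis (mubOp d (some 0)) v)
    (a : ZMod d → ℝ) (e : Err d) : Tel 2 (errOp e) (gate v a) := by
  rw [mubOp_some_zero] at hv
  obtain ⟨σ, hσ⟩ := hv.exists_gate_eq isEigenbasis_ket.1 om_injective opZ_ket
  rw [hσ, ket_eq_colVec, gate_colVec]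
  have := tel_conj 0 (a ∘ σ) e
  rw [phase_zero, Matrix.mul_one, conjTranspose_mul_opF] at this
  simpa using this

lemma tel_gate_opX {v : ZMod d → Ket d} (hv : IsEigenbasis (mubOp d none) v)
    (a : ZMod d → ℝ) (e : Err d) : Tel 2 (errOp e) (gate v a) := by
  have hF : colVec (opF d)ᴴ = fun t => ketPlus d (-t) := by
    ext t x
    simp [ketPlus, colVec, opF_apply, om_neg, mul_comm]
  obtain ⟨σ, hσ⟩ := IsEigenbasis.exists_gate_eq hv (w := colVec (opF d)ᴴ)
    (orthonormal_colVec (by rw [Matrix.conjTranspose_conjTranspose, opF_mul_conjTranspose]))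
    (om_injective.comp neg_injective) (fun t => by rw [hF]; exact opX_ketPlus (-t))
  rw [hσ, gate_colVec, Matrix.conjTranspose_conjTranspose]
  have := tel_conj (a ∘ σ) 0 e
  rwa [phase_zero, Matrix.mul_one] at this

/-- If one eigenvector has phases `c`, its products with the characters `ω^(-t x)` are eigenvectors
as well, since `X^k` only rescales a character. They are, up to normalisation, the columns of `Z(c)
F†`, and the gate is `Z(c)` after `F† Z(a) F Z(-c)`, two steps each. -/
lemma tel_gate_opZX {k : ZMod d} (hk : k ≠ 0) {v : ZMod d → Ket d}
    (hv : IsEigenbasis (mubOp d (some k)) v) (a : ZMod d → ℝ) (e : Err d) :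
    Tel 4 (errOp e) (gate v a) := by
  obtain ⟨c, hc⟩ := exists_phases hk hv 0
  obtain ⟨μ, hμ⟩ := hv.2 0
  have hμ0 : μ ≠ 0 := by
    have := norm_eigenvalue (inner_toEuclideanLin (mubOp_mem _)) hμ.apply_eq_smul hμ.2
    rintro rfl
    simp at this
  have hU : ∀ (w : Ket d) (x : ZMod d),
      Matrix.toEuclideanLin (mubOp d (some k)) w x = om d x * w (x + k) := by
    intro w x
    rw [ofLp_toEuclideanLin, mubOp, ← Matrix.mulVec_mulVec, opZ, Matrix.mulVec_diagonal,
      opX_pow_mulVec, ZMod.natCast_zmod_val]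
  have hcol : ∀ t x, colVec (phase d c * (opF d)ᴴ) t x = om d (-(t * x)) * v 0 x := by
    intro t x
    rw [hc]
    simp only [colVec, phase, Matrix.diagonal_mul, Matrix.conjTranspose_apply, opF_apply, star_mul,
      star_sqrt_inv, om_neg]
    ring
  have hW : (phase d c * (opF d)ᴴ)ᴴ = opF d * phase d (-c) := by
    rw [Matrix.conjTranspose_mul, Matrix.conjTranspose_conjTranspose, conjTranspose_phase]
  obtain ⟨σ, hσ⟩ := hv.exists_gate_eq (w := colVec (phase d c * (opF d)ᴴ))
    (μ := fun t => om d (-(t * k)) * μ)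
    (orthonormal_colVec (by
      rw [hW, Matrix.mul_assoc, ← Matrix.mul_assoc (phase d (-c)), phase_mul_phase,
        neg_add_cancel, phase_zero, Matrix.one_mul, opF_mul_conjTranspose]))
    (fun s t h => mul_right_cancel₀ hk (neg_injective (om_injective (mul_right_cancel₀ hμ0 h))))
    (fun t => by
      ext x
      have h0 := congrArg (fun w : Ket d => w x) hμ.apply_eq_smul
      simp only [hU, PiLp.smul_apply, smul_eq_mul] at h0
      rw [hU, PiLp.smul_apply, hcol, hcol, mul_add, neg_add, om_add, smul_eq_mul]
      linear_combination (om d (-(t * x)) * om d (-(t * k))) * h0)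
  rw [hσ, gate_colVec, hW]
  have h1 := tel_conj 0 c
  rw [phase_zero, Matrix.mul_one, conjTranspose_mul_opF, Matrix.one_mul] at h1
  have := tel_mul (tel_conj (a ∘ σ) (-c)) h1 e
  simpa only [Matrix.mul_assoc] using this

end Prime

/-! ### The projectors span all matrices -/

section Span

lemma pow_mem_span_proj {U : Op d} {v : ZMod d → Ket d} (hv : IsEigenbasis U v) (n : ℕ) :
    U ^ n ∈ Submodule.span ℂ (Set.range fun j => proj (v j)) := by
  obtain ⟨W, hW, rfl⟩ := exists_colVec hv.1
  choose μ hμ using hv.2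
  have hU : U * W = W * Matrix.diagonal μ := by
    ext x j
    have := congrFun (hasEigenvector_iff.mp (hμ j)).1 x
    rw [Matrix.mul_diagonal, mul_comm]
    exact this
  have hWW : W * Wᴴ = 1 := mul_eq_one_comm.mp hW
  have hn : U ^ n * W = W * Matrix.diagonal (μ ^ n) := by
    induction n with
    | zero => simp
    | succ n ih =>
      rw [pow_succ', Matrix.mul_assoc, ih, ← Matrix.mul_assoc, hU, Matrix.mul_assoc,
        Matrix.diagonal_mul_diagonal, pow_succ']
      rfl
  have : U ^ n = ∑ j, (μ ^ n) j • proj (colVec W j) := by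
    rw [sum_smul_proj_colVec, ← hn, Matrix.mul_assoc, hWW, Matrix.mul_one]
  rw [this]
  exact Submodule.sum_mem _ fun j _ => Submodule.smul_mem _ _ (Submodule.subset_span ⟨j, rfl⟩)

lemma opX_pow_congr {m n : ℕ} (h : (m : ZMod d) = n) : opX d ^ m = opX d ^ n := by
  ext i k
  rw [opX_pow_apply, opX_pow_apply, h]

lemma opZ_mul_opX_pow_pow (k n : ℕ) : ∃ c : ℂ, c ≠ 0 ∧
    opZ d ^ n * opX d ^ (k * n) = c • (opZ d * opX d ^ k) ^ n := by
  induction n with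
  | zero => exact ⟨1, one_ne_zero, by simp⟩
  | succ n ih =>
    obtain ⟨c, hc, h⟩ := ih
    have h0 : ∀ a, om d a ≠ 0 := fun a h => by simpa [h] using norm_om a
    refine ⟨om d (-((k * n : ℕ) : ZMod d)) * c, mul_ne_zero (h0 _) hc, ?_⟩
    rw [pow_succ (opZ d * _), ← smul_smul, ← Matrix.smul_mul, ← h, Matrix.mul_assoc (opZ d ^ n),
      ← Matrix.mul_assoc (opX d ^ (k * n)), opX_pow_mul_opZ, Matrix.smul_mul, Matrix.mul_smul,
      smul_smul, ← om_add, neg_add_cancel, om_zero, one_smul, pow_succ, Matrix.mul_assoc,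
      Matrix.mul_assoc, ← pow_add, mul_add, mul_one]

/-- Fourier inversion: averaging `ω^(-a x) Z^a` over `a` gives `|x⟩⟨x|`, and `X^(y - x)` sends `|y⟩`
to `|x⟩`. -/
lemma single_eq_sum (x y : ZMod d) : (Matrix.single x y 1 : Op d) =
    ∑ a : ZMod d, ((d : ℂ)⁻¹ * om d (-(a * x))) • (opZ d ^ a.val * opX d ^ (y - x).val) := by
  ext i k
  rw [Matrix.sum_apply]
  have : ∀ a : ZMod d, (((d : ℂ)⁻¹ * om d (-(a * x))) •
      (opZ d ^ a.val * opX d ^ (y - x).val)) i k =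
      om d (a * (i - x)) * ((d : ℂ)⁻¹ * if i = k - (y - x) then 1 else 0) := by
    intro a
    rw [Matrix.smul_apply, opZ_pow, Matrix.diagonal_mul, opX_pow_apply, ZMod.natCast_zmod_val,
      ZMod.natCast_zmod_val, sub_eq_add_neg i x, mul_add, om_add, mul_neg, smul_eq_mul]
    ring
  rw [Finset.sum_congr rfl fun a _ => this a, ← Finset.sum_mul, sum_om_mul, Matrix.single_apply]
  by_cases h : i = x
  · subst h
    have hd : (d : ℂ) ≠ 0 := by exact_mod_cast NeZero.ne d
    have : i = k - (y - i) ↔ y = k := by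
      constructor <;> intro h
      · linear_combination h
      · linear_combination h
    simp [this, hd]
  · simp [sub_eq_zero, h, Ne.symm h]

lemma span_real_eq_hermitian {S : Set (Op d)} (hS : ∀ P ∈ S, P.IsHermitian)
    (h : Submodule.span ℂ S = ⊤) (H : Op d) :
    H ∈ Submodule.span ℝ S ↔ H.IsHermitian := by
  constructor
  · intro hH
    induction hH using Submodule.span_induction with
    | mem P hP => exact hS P hP
    | zero => exact Matrix.isHermitian_zero
    | add _ _ _ _ h1 h2 => exact h1.add h2
    | smul r _ _ h => rw [Matrix.IsHermitian, Matrix.conjTranspose_smul, h]; simp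
  · intro hH
    -- The arbitrary scalar `c` lets the induction absorb complex coefficients; `c = 1/2` recovers a
    -- Hermitian matrix.
    have key : ∀ M ∈ Submodule.span ℂ S, ∀ c : ℂ, c • M + (c • M)ᴴ ∈ Submodule.span ℝ S := by
      intro M hM
      induction hM using Submodule.span_induction with
      | mem P hP =>
        intro c
        have : c • P + (c • P)ᴴ = (2 * c.re) • P := by
          rw [Matrix.conjTranspose_smul, hS P hP, ← add_smul]
          ext i j
          have : c + star c = ((2 * c.re : ℝ) : ℂ) := Complex.add_conj c
          rw [this]
          simp
        rw [this]
        exact Submodule.smul_mem _ _ (Submodule.subset_span hP)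
      | zero => simp
      | add A B _ _ h1 h2 =>
        intro c
        have := add_mem (h1 c) (h2 c)
        rw [smul_add, Matrix.conjTranspose_add]
        rwa [add_add_add_comm] at this
      | smul r A _ h =>
        intro c
        rw [smul_smul]
        exact h _
    have := key H (h ▸ Submodule.mem_top) ((1 / 2 : ℝ) : ℂ)
    rw [Matrix.conjTranspose_smul, hH, ← add_smul] at this
    convert this
    norm_num

lemma proj_isHermitian (v : Ket d) : (proj v).IsHermitian := by
  ext x y
  simp [proj, mul_comm]

end Span

section Prime

variable {d : ℕ} [Fact d.Prime]

lemma span_proj_eq_top {v : Option (ZMod d) → ZMod d → Ket d}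
    (hv : ∀ i, IsEigenbasis (mubOp d i) (v i)) :
    Submodule.span ℂ {P : Op d | ∃ i j, P = proj (v i j)} = ⊤ := by
  rw [eq_top_iff]
  rintro M -
  have hpow : ∀ i n, mubOp d i ^ n ∈ Submodule.span ℂ {P : Op d | ∃ i j, P = proj (v i j)} := by
    intro i n
    refine Submodule.span_mono ?_ (pow_mem_span_proj (hv i) n)
    rintro _ ⟨j, rfl⟩
    exact ⟨i, j, rfl⟩
  have hweyl : ∀ a b : ZMod d, opZ d ^ a.val * opX d ^ b.val ∈
      Submodule.span ℂ {P : Op d | ∃ i j, P = proj (v i j)} := by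
    intro a b
    by_cases ha : a = 0
    · subst ha
      simpa [mubOp] using hpow none b.val
    -- `Z^a X^b` is proportional to `(Z X^(b/a))^a`; the division needs `d` prime.
    · obtain ⟨c, -, h⟩ := opZ_mul_opX_pow_pow (d := d) (b / a).val a.val
      rw [opX_pow_congr (m := b.val) (n := (b / a).val * a.val)
        (by push_cast; simp [div_mul_cancel₀ b ha]), h]
      exact Submodule.smul_mem _ _ (hpow (some (b / a)) a.val)
  rw [Matrix.matrix_eq_sum_single M]
  refine Submodule.sum_mem _ fun x _ => Submodule.sum_mem _ fun y _ => ?_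
  rw [← mul_one (M x y), ← smul_eq_mul, ← Matrix.smul_single, single_eq_sum]
  exact Submodule.smul_mem _ _ (Submodule.sum_mem _ fun a _ =>
    Submodule.smul_mem _ _ (hweyl a (y - x)))

end Prime

/-! ### Products of gates exhaust the unitary group -/

section Universality

open scoped Matrix.Norms.L2Operator

variable {ι : Type*} [Fintype ι]

lemma gate_mem {v : ZMod d → Ket d} (hv : Orthonormal ℂ v) (a : ZMod d → ℝ) :
    gate v a ∈ Matrix.unitaryGroup (ZMod d) ℂ := by
  obtain ⟨W, hW, rfl⟩ := exists_colVec hv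
  rw [Matrix.mem_unitaryGroup_iff', gate_colVec, Matrix.star_eq_conjTranspose,
    Matrix.conjTranspose_mul, Matrix.conjTranspose_mul, Matrix.conjTranspose_conjTranspose,
    conjTranspose_phase]
  calc W * (phase d (-a) * Wᴴ) * (W * phase d a * Wᴴ)
      = W * (phase d (-a) * ((Wᴴ * W) * phase d a)) * Wᴴ := by simp only [Matrix.mul_assoc]
    _ = 1 := by
      rw [hW, Matrix.one_mul, phase_mul_phase, neg_add_cancel, phase_zero, Matrix.mul_one,
        mul_eq_one_comm.mp hW]

lemma gate_const {v : ZMod d → Ket d} (hv : Orthonormal ℂ v) (r : ℝ) :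
    gate v (fun _ => r) = Complex.exp (Complex.I * r) • (1 : Op d) := by
  obtain ⟨W, hW, rfl⟩ := exists_colVec hv
  have : phase d (fun _ => r) = Complex.exp (Complex.I * r) • (1 : Op d) := by
    rw [phase, Matrix.smul_one_eq_diagonal]
  rw [gate_colVec, this, Matrix.mul_smul, Matrix.smul_mul, Matrix.mul_one,
    mul_eq_one_comm.mp hW]

/-- The derivative at `0` of the gate with phases `Im (c i j)`. -/
def gateDeriv (v : ι → ZMod d → Ket d) (i : ι) : (ι → ZMod d → ℂ) →L[ℝ] Op d :=
  ∑ j, (Complex.I • Complex.ofRealCLM.comp (Complex.imCLM.comp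
    ((ContinuousLinearMap.proj j : (ZMod d → ℂ) →L[ℝ] ℂ).comp
      (ContinuousLinearMap.proj i : (ι → ZMod d → ℂ) →L[ℝ] (ZMod d → ℂ))))).smulRight
    (proj (v i j))

lemma hasStrictFDerivAt_gate (v : ι → ZMod d → Ket d) (i : ι) :
    HasStrictFDerivAt (fun c : ι → ZMod d → ℂ => gate (v i) fun j => (c i j).im)
      (gateDeriv v i) 0 := by
  unfold gate gateDeriv
  refine HasStrictFDerivAt.fun_sum fun j _ => ?_
  have h := ((Complex.I • Complex.ofRealCLM.comp (Complex.imCLM.comp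
    ((ContinuousLinearMap.proj j : (ZMod d → ℂ) →L[ℝ] ℂ).comp
      (ContinuousLinearMap.proj i : (ι → ZMod d → ℂ) →L[ℝ] (ZMod d → ℂ))))).hasStrictFDerivAt
      (x := 0)).cexp.smul_const (proj (v i j))
  simpa using h

/-- All factors equal `1` at the origin, so the product rule merely adds their derivatives; the
value at `0` is carried along for the induction. -/
lemma hasStrictFDerivAt_gate_prod {v : ι → ZMod d → Ket d} (hv : ∀ i, Orthonormal ℂ (v i))
    (l : List ι) :
    HasStrictFDerivAt
      (fun c : ι → ZMod d → ℂ => (l.map fun i => gate (v i) fun j => (c i j).im).prod)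
      (l.map (gateDeriv v)).sum 0 ∧
    (l.map fun i => gate (v i) fun j => ((0 : ι → ZMod d → ℂ) i j).im).prod = 1 := by
  induction l with
  | nil => exact ⟨by simpa using hasStrictFDerivAt_const _ _, by simp⟩
  | cons i l ih =>
    have h1 : (gate (v i) fun j => ((0 : ι → ZMod d → ℂ) i j).im) = 1 := by
      simpa using gate_const (hv i) 0
    refine ⟨?_, by rw [List.map_cons, List.prod_cons, h1, ih.2, one_mul]⟩
    have h := (hasStrictFDerivAt_gate v i).mul' ih.1
    rw [h1, ih.2] at h
    rw [MulOpposite.op_one, one_smul, one_smul, add_comm] at h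
    simp only [List.map_cons, List.prod_cons, List.sum_cons]
    exact h

/-- Every matrix near `1` is the product of gates and a self-adjoint matrix near `1`. -/
lemma exists_gate_prod_mul {v : ι → ZMod d → Ket d} (hv : ∀ i, Orthonormal ℂ (v i))
    (hspan : Submodule.span ℂ {P : Op d | ∃ i j, P = proj (v i j)} = ⊤) :
    ∀ᶠ M : Op d in nhds 1, ∃ (c : ι → ZMod d → ℝ) (H : Op d), ‖H‖ < 1 ∧ H.IsHermitian ∧
      M = (Finset.univ.toList.map fun i => gate (v i) (c i)).prod * (1 + H) := by
  let L : (ι → ZMod d → ℂ) →L[ℝ] Op d := LinearMap.toContinuousLinearMap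
    (∑ i, ∑ j, (Complex.ofRealCLM.comp (Complex.reCLM.comp
      ((ContinuousLinearMap.proj j : (ZMod d → ℂ) →L[ℝ] ℂ).comp
        (ContinuousLinearMap.proj i : (ι → ZMod d → ℂ) →L[ℝ] (ZMod d → ℂ))))).smulRight
      (proj (v i j)) : (ι → ZMod d → ℂ) →L[ℝ] Op d).toLinearMap
  have hL : ∀ c, L c = ∑ i, ∑ j, ((c i j).re : ℂ) • proj (v i j) := by
    intro c
    simp [L]
  obtain ⟨h1, h2⟩ := hasStrictFDerivAt_gate_prod hv Finset.univ.toList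
  have h := h1.mul' ((hasStrictFDerivAt_const (1 : Op d) 0).add L.hasStrictFDerivAt)
  have hsurj : Function.Surjective
      ((Finset.univ.toList.map (gateDeriv v)).sum + L) := by
    intro M
    have hM : M ∈ Submodule.span ℂ (Set.range fun p : ι × ZMod d => proj (v p.1 p.2)) := by
      have : (Set.range fun p : ι × ZMod d => proj (v p.1 p.2)) =
          {P : Op d | ∃ i j, P = proj (v i j)} := by
        ext P; simp [eq_comm]
      rw [this, hspan]
      exact Submodule.mem_top
    obtain ⟨c, rfl⟩ := (Submodule.mem_span_range_iff_exists_fun ℂ).mp hM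
    refine ⟨fun i j => c (i, j), ?_⟩
    rw [Finset.sum_map_toList, _root_.add_apply, hL, _root_.sum_apply,
      ← Finset.sum_add_distrib, Fintype.sum_prod_type]
    refine Finset.sum_congr rfl fun i _ => ?_
    rw [gateDeriv, _root_.sum_apply, ← Finset.sum_add_distrib]
    refine Finset.sum_congr rfl fun j _ => ?_
    -- Imaginary parts enter through the gates and real parts through `L`, so the total derivative
    -- is `c ↦ ∑ c i j • proj (v i j)`.
    have : c (i, j) = Complex.I * ((c (i, j)).im : ℂ) + ((c (i, j)).re : ℂ) := by
      conv_lhs => rw [← Complex.re_add_im (c (i, j))]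
      ring
    conv_rhs => rw [this, add_smul]
    simp
  have hone : ((fun _ => 1) + ⇑L : (ι → ZMod d → ℂ) → Op d) 0 = 1 := by simp
  rw [h2, hone, zero_add, one_smul, MulOpposite.op_one, one_smul, add_comm L] at h
  have hmap := h.map_nhds_eq_of_surj (LinearMap.range_eq_top.mpr hsurj)
  have hnhds : {c : ι → ZMod d → ℂ | ‖L c‖ < 1} ∈ nhds 0 :=
    (isOpen_lt L.continuous.norm continuous_const).mem_nhds (by simp)
  have himg := hmap.ge (Filter.image_mem_map hnhds)
  simp only [Pi.mul_apply, Pi.add_apply, h2, map_zero, add_zero, mul_one] at himg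
  filter_upwards [himg]
  rintro _ ⟨c, hc, rfl⟩
  refine ⟨fun i j => (c i j).im, L c, hc, ?_, rfl⟩
  rw [hL, Matrix.IsHermitian, Matrix.conjTranspose_sum]
  refine Finset.sum_congr rfl fun i _ => ?_
  rw [Matrix.conjTranspose_sum]
  refine Finset.sum_congr rfl fun j _ => ?_
  rw [Matrix.conjTranspose_smul, proj_isHermitian]
  simp

/-- Unitarity reads `(1 + H)² = 1`, so `2H = -H²` and `2‖H‖ ≤ ‖H‖²`, impossible for `0 < ‖H‖ < 1`.
-/
lemma eq_zero_of_one_add_mem_unitary {H : Op d} (hH : H.IsHermitian) (hn : ‖H‖ < 1)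
    (hU : 1 + H ∈ Matrix.unitaryGroup (ZMod d) ℂ) : H = 0 := by
  rw [Matrix.mem_unitaryGroup_iff, Matrix.star_eq_conjTranspose, Matrix.conjTranspose_add, hH,
    Matrix.conjTranspose_one] at hU
  have h2 : (2 : ℝ) • H = -(H * H) := by
    simp only [add_mul, mul_add, one_mul, mul_one] at hU
    have h1 : H + H + H * H = (1 + H + (H + H * H)) - 1 := by abel
    rw [two_smul]
    exact eq_neg_of_add_eq_zero_left (by rw [h1, hU, sub_self])
  have h3 := congrArg norm h2
  rw [norm_smul, norm_neg] at h3
  have h4 := norm_mul_le H H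
  rw [← norm_eq_zero]
  have h5 : ‖(2 : ℝ)‖ = 2 := by norm_num
  rw [h5] at h3
  nlinarith [norm_nonneg H]

/-- The finite spectrum misses a point of the unit circle; rotating that point to `-1` makes the
principal logarithm available. -/
lemma exists_smul_eq_exp {U : Op d} (hU : U ∈ Matrix.unitaryGroup (ZMod d) ℂ) :
    ∃ (r : ℝ) (x : selfAdjoint (Op d)),
      (selfAdjoint.expUnitary x : Op d) = Complex.exp (Complex.I * r) • U := by
  obtain ⟨r, hr⟩ : ∃ r : ℝ, Complex.exp (r * Complex.I) ∉ spectrum ℂ U := by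
    by_contra! h
    refine Set.infinite_of_injOn_mapsTo (f := fun r : ℝ => Complex.exp (r * Complex.I))
      (s := Set.Ioo (0 : ℝ) 1) (fun r hr s hs hrs => ?_) (fun r _ => h r)
      (Set.Ioo_infinite one_pos) (Matrix.finite_spectrum (R := ℂ) U)
    have harg : ∀ t ∈ Set.Ioo (0 : ℝ) 1, (Complex.exp (t * Complex.I)).arg = t := by
      intro t ht
      rw [Complex.arg_exp_mul_I, toIocMod_eq_self]
      constructor <;> linarith [ht.1, ht.2, Real.pi_gt_three]
    rw [← harg r hr, ← harg s hs]
    exact congrArg Complex.arg hrs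
  refine ⟨Real.pi - r, ?_⟩
  set c := Complex.exp (Complex.I * ((Real.pi - r : ℝ) : ℂ)) with hc
  have hcr : c * Complex.exp (r * Complex.I) = -1 := by
    rw [hc, ← Complex.exp_add, ← Complex.exp_pi_mul_I]
    congr 1
    push_cast
    ring
  have hcn : star c * c = 1 := by
    have : ‖c‖ = 1 := by rw [hc, mul_comm, Complex.norm_exp_ofReal_mul_I]
    simpa [this] using RCLike.conj_mul c
  have hcU : c • U ∈ unitary (Op d) := by
    rw [Matrix.mem_unitaryGroup_iff'] at hU
    have : star (c • U) * (c • U) = 1 := by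
      rw [star_smul, Matrix.smul_mul, Matrix.mul_smul, hU, smul_smul, hcn, one_smul]
    exact Unitary.mem_iff.mpr ⟨this, mul_eq_one_comm.mp this⟩
  refine ⟨Unitary.argSelfAdjoint ⟨c • U, hcU⟩, ?_⟩
  rw [expUnitary_argSelfAdjoint]
  rw [Unitary.norm_sub_one_lt_two_iff hcU, spectrum.mem_iff, not_not]
  rw [spectrum.mem_iff, not_not] at hr
  have hc0 : IsUnit (algebraMap ℂ (Op d) c) := (IsUnit.mk0 c (Complex.exp_ne_zero _)).map _
  have := hc0.mul hr
  rwa [mul_sub, ← map_mul, hcr, ← Algebra.smul_def] at this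

/-- With `exp(ix)` a scalar multiple of `U`, its root `exp(ix/(n + 1))` lies near `1` for suitable
`n`, hence in `K`. -/
lemma mem_of_near_one {K : Submonoid (Op d)}
    (hK : ∀ᶠ M : Op d in nhds 1, M ∈ Matrix.unitaryGroup (ZMod d) ℂ → M ∈ K)
    (hscalar : ∀ r : ℝ, Complex.exp (Complex.I * r) • (1 : Op d) ∈ K)
    {U : Op d} (hU : U ∈ Matrix.unitaryGroup (ZMod d) ℂ) : U ∈ K := by
  obtain ⟨r, x, hx⟩ := exists_smul_eq_exp hU
  have hlim : Filter.Tendsto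
      (fun n : ℕ => (selfAdjoint.expUnitary ((1 / ((n : ℝ) + 1)) • x) : Op d)) Filter.atTop
      (nhds 1) := by
    have h1 : Filter.Tendsto (fun n : ℕ => (1 / ((n : ℝ) + 1)) • x) Filter.atTop (nhds 0) := by
      simpa using (tendsto_one_div_add_atTop_nhds_zero_nat (𝕜 := ℝ)).smul_const x
    have h2 := (continuous_subtype_val.comp
      (selfAdjoint.continuous_expUnitary (A := Op d))).tendsto 0
    have h3 := h2.comp h1
    rwa [Function.comp_apply, selfAdjoint.expUnitary_zero] at h3
  obtain ⟨n, hn⟩ := (hlim.eventually hK).exists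
  have hmem := hn (selfAdjoint.expUnitary _).2
  have hpow : (selfAdjoint.expUnitary ((1 / ((n : ℝ) + 1)) • x) : Op d) ^ (n + 1) =
      selfAdjoint.expUnitary x := by
    let : NormedAlgebra ℚ (Op d) := .restrictScalars ℚ ℂ (Op d)
    rw [selfAdjoint.expUnitary_coe, selfAdjoint.expUnitary_coe, ← NormedSpace.exp_nsmul]
    congr 1
    have hn0 : (n : ℝ) + 1 ≠ 0 := by positivity
    have hx1 : (n + 1) • ((1 / ((n : ℝ) + 1)) • x) = x := by
      rw [← Nat.cast_smul_eq_nsmul ℝ, smul_smul, Nat.cast_succ, mul_one_div_cancel hn0, one_smul]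
    rw [smul_comm]
    exact congrArg (fun y : selfAdjoint (Op d) => Complex.I • (y : Op d)) hx1
  have hU' : U = (Complex.exp (Complex.I * ((-r : ℝ) : ℂ)) • (1 : Op d)) *
      selfAdjoint.expUnitary x := by
    rw [hx, Matrix.smul_mul, Matrix.one_mul, smul_smul, ← Complex.exp_add]
    simp
  rw [hU', ← hpow]
  exact mul_mem (hscalar _) (pow_mem hmem _)

lemma gate_mem_gateSet (v : Option (ZMod d) → ZMod d → Ket d) (i : Option (ZMod d))
    (a : ZMod d → ℝ) : gate (v i) a ∈ gateSet v := by
  refine ⟨i, fun j => toIcoMod Real.two_pi_pos 0 (a j), fun j => ?_, ?_⟩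
  · have := toIcoMod_mem_Ico' Real.two_pi_pos (a j)
    exact ⟨this.1, this.2.le⟩
  · refine Finset.sum_congr rfl fun j _ => ?_
    congr 1
    rw [Complex.exp_eq_exp_iff_exists_int]
    refine ⟨toIcoDiv Real.two_pi_pos 0 (a j), ?_⟩
    simp only [← self_sub_toIcoDiv_zsmul]
    push_cast [zsmul_eq_mul]
    ring

lemma closure_gateSet {v : Option (ZMod d) → ZMod d → Ket d} (hv : ∀ i, Orthonormal ℂ (v i))
    (hspan : Submodule.span ℂ {P : Op d | ∃ i j, P = proj (v i j)} = ⊤) :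
    Submonoid.closure (gateSet v) = Matrix.unitaryGroup (ZMod d) ℂ := by
  apply le_antisymm
  · rw [Submonoid.closure_le]
    rintro _ ⟨i, a, -, rfl⟩
    exact gate_mem (hv i) a
  · intro U hU
    refine mem_of_near_one ?_ (fun r => ?_) hU
    · filter_upwards [exists_gate_prod_mul hv hspan] with M hM hMU
      obtain ⟨c, H, hn, hH, rfl⟩ := hM
      have hP : (Finset.univ.toList.map fun i => gate (v i) (c i)).prod ∈
          Matrix.unitaryGroup (ZMod d) ℂ := by
        refine list_prod_mem fun G hG => ?_
        obtain ⟨i, -, rfl⟩ := List.mem_map.mp hG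
        exact gate_mem (hv i) _
      -- Cancelling the unitary product of gates leaves `1 + H` unitary, which forces `H = 0`.
      have hH' : 1 + H ∈ Matrix.unitaryGroup (ZMod d) ℂ := by
        have := mul_mem (Unitary.star_mem hP) hMU
        rwa [← mul_assoc, (Unitary.mem_iff.mp hP).1, one_mul] at this
      rw [eq_zero_of_one_add_mem_unitary hH hn hH', add_zero, mul_one]
      refine list_prod_mem fun G hG => ?_
      obtain ⟨i, -, rfl⟩ := List.mem_map.mp hG
      exact Submonoid.subset_closure (gate_mem_gateSet v i _)
    · rw [← gate_const (hv none)]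
      exact Submonoid.subset_closure (gate_mem_gateSet v none _)

end Universality

/-! ### Implementing arbitrary unitaries -/

section Prime

variable {d : ℕ} [Fact d.Prime]

lemma exists_tel_of_mem_unitaryGroup {U : Op d} (hU : U ∈ Matrix.unitaryGroup (ZMod d) ℂ) :
    ∃ n, ∀ e : Err d, Tel n (errOp e) U := by
  choose v hv using exists_isEigenbasis (d := d)
  rw [← closure_gateSet (fun i => (hv i).1) (span_proj_eq_top hv)] at hU
  induction hU using Submonoid.closure_induction with
  | mem G hG =>
    obtain ⟨i, a, -, rfl⟩ := hG
    match i with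
    | none => exact ⟨2, tel_gate_opX (hv none) a⟩
    | some k =>
      by_cases hk : k = 0
      · subst hk
        exact ⟨2, tel_gate_opZ (hv (some 0)) a⟩
      · exact ⟨4, tel_gate_opZX hk (hv (some k)) a⟩
  | one => exact ⟨0, fun e => ⟨e, 1, by simp, by simp⟩⟩
  | mul G H _ _ hG hH =>
    obtain ⟨n, hn⟩ := hG
    obtain ⟨k, hk⟩ := hH
    exact ⟨n + k, tel_mul hk hn⟩

end Prime

end QuditCluster

end

open QuditCluster
theorem mainTheorem2 (d : ℕ) [Fact d.Prime] :
    IsEigenbasis (opZ d) (ket d) ∧ IsEigenbasis (opX d) (ketPlus d) ∧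
    (∀ i : Option (ZMod d), ∃ v : ZMod d → Ket d, IsEigenbasis (mubOp d i) v) ∧
    (∀ v : Option (ZMod d) → ZMod d → Ket d, (∀ i, IsEigenbasis (mubOp d i) (v i)) →
      (∀ i i', i ≠ i' → MutuallyUnbiased (v i) (v i')) ∧
      (∀ H : Op d,
        H ∈ Submodule.span ℝ {P : Op d | ∃ i j, P = proj (v i j)} ↔ H.IsHermitian) ∧
      (∀ a : ZMod d → ℝ, Implements 2 (gate (v (some 0)) a)) ∧
      (∀ a : ZMod d → ℝ, Implements 2 (gate (v none) a)) ∧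
      (∀ k : ZMod d, k ≠ 0 → ∀ a : ZMod d → ℝ, Implements 4 (gate (v (some k)) a)) ∧
      Submonoid.closure (gateSet v) = Matrix.unitaryGroup (ZMod d) ℂ) ∧
    (∀ U ∈ Matrix.unitaryGroup (ZMod d) ℂ, ∃ n : ℕ, Implements n U) := by
  refine ⟨isEigenbasis_ket, isEigenbasis_ketPlus, exists_isEigenbasis, fun v hv => ⟨?_, ?_, ?_, ?_,
    ?_, ?_⟩, fun U hU => ?_⟩
  · exact fun i i' h => mutuallyUnbiased_of_isEigenbasis h (hv i) (hv i')
  · refine span_real_eq_hermitian ?_ (span_proj_eq_top hv)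
    rintro _ ⟨i, j, rfl⟩
    exact proj_isHermitian _
  · exact fun a => implements_of_tel (tel_gate_opZ (hv _) a)
  · exact fun a => implements_of_tel (tel_gate_opX (hv _) a)
  · exact fun k hk a => implements_of_tel (tel_gate_opZX hk (hv _) a)
  · exact closure_gateSet (fun i => (hv i).1) (span_proj_eq_top hv)
  · obtain ⟨n, hn⟩ := exists_tel_of_mem_unitaryGroup hU
    exact ⟨n, implements_of_tel hn⟩
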